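/- Let $\mathsf{Var}$ be a countably infinite set of propositional variables, and let $\mathcal L_\Box^{\langle n\rangle}$ be the set of formulas built from the atoms $p\in\mathsf{Var}$ and $\top$ by $\neg$, $\wedge$, $\Box$ and the counting modalities $\langle n\rangle$ for $n<\omega$. Given a topological space $X$, an assignment $h:\mathsf{Var}\to\wp(X)$ and a point $x\in X$, truth is defined by: $(X,h),x\models p$ iff $x\in h(p)$; $\top$, $\neg$, $\wedge$ are interpreted as usual; $(X,h),x\models\Box\varphi$ iff there is an open neighbourhood $O$ of $x$ with $(X,h),y\models\varphi$ for every $y\in O$; and $(X,h),x\models\langle n\rangle\varphi$ iff $|\{y\in X:(X,h),y\models\varphi\}|>n$. A set $\Sigma$ of formulas is satisfiable in $X$ if there are an assignment $h$ into $X$ and a point $x\in X$ such that $(X,h),x\models\varphi$ for every $\varphi\in\Sigma$; it is finitely satisfiable in $X$ if every finite subset of $\Sigma$ is satisfiable in $X$. **Theorem.** The language $\mathcal L_\Box^{\langle n\rangle}$ is compact over the Cantor set $\mathbb C$: every set $\Sigma$ of $\mathcal L_\Box^{\langle n\rangle}$-formulas that is finitely satisfiable in $\mathbb C$ is satisfiable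 in $\mathbb C$. -/

import Mathlib

/-- Formulas of the modal language with `□` and the counting modalities `⟨n⟩` (`n < ω`),
over the set `Var` of propositional variables. -/
inductive CountFormula (Var : Type*) where
  | atom (p : Var) : CountFormula Var
  | top : CountFormula Var
  | neg (φ : CountFormula Var) : CountFormula Var
  | and (φ ψ : CountFormula Var) : CountFormula Var
  | box (φ : CountFormula Var) : CountFormula Var
  | count (n : ℕ) (φ : CountFormula Var) : CountFormula Var

namespace CountFormula

/-- Truth of a formula at a point `x` of the topological model `(X, h)`. -/
def TrueAt {Var X : Type*} [TopologicalSpace X] (h : Var → Set X) :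
    CountFormula Var → X → Prop
  | atom p, x => x ∈ h p
  | top, _ => True
  | neg φ, x => ¬ TrueAt h φ x
  | and φ ψ, x => TrueAt h φ x ∧ TrueAt h ψ x
  | box φ, x => ∃ O : Set X, IsOpen O ∧ x ∈ O ∧ ∀ y ∈ O, TrueAt h φ y
  | count n φ, _ => (n : ℕ∞) < {y : X | TrueAt h φ y}.encard

/-- A set of formulas is satisfiable in `X` if, for some assignment into `X`, all its members
are true together at some point of `X`. -/
def Satisfiable {Var : Type*} (X : Type*) [TopologicalSpace X]
    (Γ : Set (CountFormula Var)) : Prop :=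
  ∃ (h : Var → Set X) (x : X), ∀ γ ∈ Γ, TrueAt h γ x

/-- A set of formulas is finitely satisfiable in `X` if each of its finite subsets is
satisfiable in `X` (possibly under different assignments). -/
def FinitelySatisfiable {Var : Type*} (X : Type*) [TopologicalSpace X]
    (Γ : Set (CountFormula Var)) : Prop :=
  ∀ Γ₀ ⊆ Γ, Γ₀.Finite → Satisfiable X Γ₀

/-- The language over `Var` is compact over `X`: every set of formulas that is finitely
satisfiable in `X` is satisfiable in `X`. -/
def LanguageCompactOver (Var X : Type*) [TopologicalSpace X] : Prop :=
  ∀ Γ : Set (CountFormula Var), FinitelySatisfiable X Γ → Satisfiable X Γ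

end CountFormula

/-! Take models of the finite subsets of Γ on the Cantor space and an ultrafilter `U` on these
subsets that contains the eventual ones. An ultraproduct of the models does not live on the Cantor
space, so the limit model is built on `ℕ → Bool` directly. Each model is given fresh binary
coordinates (addresses), and points of different models are compared through their addresses.

Coordinates are chosen so that any two disjoint closed sets from a countable list of names are told
apart by a number of coordinates that is the same for all models. The names cover chosen witnesses
for formulas and the closed sets `¬□ψ` cut down to a cylinder. Uniformity makes separation survive
the limit (`exists_addressedModel`): distinct named points keep distinct limits, and if `¬□ψ`
accumulates at the limit of a named point, it holds at that point in almost all models.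

Each address `u` then receives an ultrafilter of pairs (model, point) converging to `u` and
containing every `¬□ψ` that accumulates at `u`; at limits of named points it is the one given by the
name. The truth lemma `trueAt_limitVal_iff` says that truth at `u` is truth along this ultrafilter.
-/

open PiNat Set Filter Topology

/-! ### Separating clopen coordinates on a perfect Stone space -/

section Coordinates

variable {X : Type*} [TopologicalSpace X] [CompactSpace X] [T2Space X]
  [TotallyDisconnectedSpace X]

/-- In a Stone space without isolated points, every nonempty clopen set is split by a clopen set
that decides membership in a given clopen set. -/
theorem IsClopen.exists_split (hX : ∀ x : X, ¬ IsOpen {x}) {V C : Set X} (hV : IsClopen V)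
    (hne : V.Nonempty) (hC : IsClopen C) :
    ∃ H : Set X, IsClopen H ∧ (V ∩ H).Nonempty ∧ (V ∩ Hᶜ).Nonempty ∧
      ∀ x ∈ V, ∀ y ∈ V, (x ∈ H ↔ y ∈ H) → (x ∈ C ↔ y ∈ C) := by
  obtain ⟨x, hx⟩ := hne
  obtain ⟨y, hy, hxy⟩ : ∃ y ∈ V, x ≠ y := by
    by_contra! hcon
    refine hX x ?_
    convert hV.isOpen
    exact Subset.antisymm (singleton_subset_iff.2 hx) fun y hy => (hcon y hy).symm
  obtain ⟨H, hH, hxH, hyH⟩ := exists_isClopen_of_totally_separated hxy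
  by_cases h1 : (V ∩ C).Nonempty
  · by_cases h2 : (V ∩ Cᶜ).Nonempty
    · exact ⟨C, hC, h1, h2, fun x _ y _ h => h⟩
    · have key : ∀ z ∈ V, z ∈ C := fun z hz => by
        by_contra hzC
        exact h2 ⟨z, hz, hzC⟩
      exact ⟨H, hH, ⟨x, hx, hxH⟩, ⟨y, hy, hyH⟩,
        fun a ha b hb _ => iff_of_true (key a ha) (key b hb)⟩
  · exact ⟨H, hH, ⟨x, hx, hxH⟩, ⟨y, hy, hyH⟩,
      fun a ha b hb _ => iff_of_false (fun h => h1 ⟨a, ha, h⟩) (fun h => h1 ⟨b, hb, h⟩)⟩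

/-- A locally constant surjection onto the words of length `n` can be refined to one onto the words
of length `n + 1` so as to decide membership in a given clopen set. -/
theorem IsLocallyConstant.exists_refinement (hX : ∀ x : X, ¬ IsOpen {x}) {n : ℕ}
    {e : X → List Bool} (he : IsLocallyConstant e) (hsurj : ∀ s : List Bool, s.length = n →
      ∃ x, e x = s) (hlen : ∀ x, (e x).length = n) {C : Set X} (hC : IsClopen C) :
    ∃ g : X → Bool, IsLocallyConstant (fun x => g x :: e x) ∧
      (∀ s : List Bool, s.length = n + 1 → ∃ x, g x :: e x = s) ∧
      ∀ x y, g x :: e x = g y :: e y → (x ∈ C ↔ y ∈ C) := by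
  classical
  have hsplit : ∀ s : List Bool, ∃ H : Set X, IsClopen H ∧ (s.length = n →
      (e ⁻¹' {s} ∩ H).Nonempty ∧ (e ⁻¹' {s} ∩ Hᶜ).Nonempty ∧
      ∀ x ∈ e ⁻¹' {s}, ∀ y ∈ e ⁻¹' {s}, (x ∈ H ↔ y ∈ H) → (x ∈ C ↔ y ∈ C)) := by
    intro s
    by_cases hs : s.length = n
    · obtain ⟨x, hx⟩ := hsurj s hs
      obtain ⟨H, hH, h⟩ := IsClopen.exists_split hX (he.isClopen_fiber s) ⟨x, hx⟩ hC
      exact ⟨H, hH, fun _ => h⟩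
    · exact ⟨∅, isClopen_empty, fun h => absurd h hs⟩
  choose H hH hsp using hsplit
  refine ⟨fun x => decide (x ∈ H (e x)), ?_, ?_, ?_⟩
  · rw [IsLocallyConstant.iff_eventually_eq]
    intro x
    have h1 := (IsLocallyConstant.iff_eventually_eq e).1 he x
    have h2 : ∀ᶠ y in 𝓝 x, (y ∈ H (e x) ↔ x ∈ H (e x)) := by
      by_cases hx : x ∈ H (e x)
      · filter_upwards [(hH (e x)).isOpen.mem_nhds hx] with y hy
        exact iff_of_true hy hx
      · filter_upwards [(hH (e x)).compl.isOpen.mem_nhds hx] with y hy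
        exact iff_of_false hy hx
    filter_upwards [h1, h2] with y hy1 hy2
    simp [hy1, hy2]
  · intro s hs
    match s, hs with
    | b :: s, hs =>
      have hs' : s.length = n := by simpa using hs
      obtain ⟨⟨x, hx, hxH⟩, ⟨y, hy, hyH⟩, -⟩ := hsp s hs'
      cases b with
      | true =>
        refine ⟨x, ?_⟩
        have hx' : e x = s := hx
        simp [hx', hxH]
      | false =>
        refine ⟨y, ?_⟩
        have hy' : e y = s := hy
        have : y ∉ H s := hyH
        simp [hy', this]
  · intro x y hxy
    simp only [List.cons.injEq, decide_eq_decide] at hxy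
    refine (hsp (e x) (hlen x)).2.2 x rfl y hxy.2.symm ?_
    rw [hxy.1, hxy.2]

/-- A Stone space without isolated points has a map to the Cantor space, all of whose truncations
are continuous and surjective, and which separates, for every `n`, two closed sets that
depend on the first `n` coordinates of the map. -/
theorem exists_separating_coordinates [Nonempty X] (hX : ∀ x : X, ¬ IsOpen {x})
    (A B : ℕ → (X → List Bool) → Set X) :
    ∃ f : X → ℕ → Bool, (∀ n, IsLocallyConstant fun x => res (f x) n) ∧
      (∀ s : List Bool, ∃ x, res (f x) s.length = s) ∧
      ∀ n, IsClosed (A n fun x => res (f x) n) → IsClosed (B n fun x => res (f x) n) →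
        Disjoint (A n fun x => res (f x) n) (B n fun x => res (f x) n) →
        ∀ x ∈ A n fun x => res (f x) n, ∀ y ∈ B n fun x => res (f x) n,
          res (f x) (n + 1) ≠ res (f y) (n + 1) := by
  -- The assumptions on `e` stand inside `∃ g`, so that `choose` gives a total function of `n` and
  -- `e` along which one can recurse; for bad `e` its value is irrelevant.
  have hstep : ∀ (n : ℕ) (e : X → List Bool), ∃ g : X → Bool, IsLocallyConstant e →
      (∀ s : List Bool, s.length = n → ∃ x, e x = s) → (∀ x, (e x).length = n) →
      IsLocallyConstant (fun x => g x :: e x) ∧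
      (∀ s : List Bool, s.length = n + 1 → ∃ x, g x :: e x = s) ∧
      (IsClosed (A n e) → IsClosed (B n e) → Disjoint (A n e) (B n e) →
        ∀ x ∈ A n e, ∀ y ∈ B n e, g x :: e x ≠ g y :: e y) := by
    intro n e
    by_cases he : IsLocallyConstant e ∧ (∀ s : List Bool, s.length = n → ∃ x, e x = s) ∧
      ∀ x, (e x).length = n
    · obtain ⟨C, hC, hAB⟩ : ∃ C : Set X, IsClopen C ∧ (IsClosed (A n e) → IsClosed (B n e) →
          Disjoint (A n e) (B n e) → A n e ⊆ C ∧ C ⊆ (B n e)ᶜ) := by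
        by_cases h : IsClosed (A n e) ∧ IsClosed (B n e) ∧ Disjoint (A n e) (B n e)
        · obtain ⟨C, hC, h1, h2⟩ := exists_clopen_of_closed_subset_open h.1 h.2.1.isOpen_compl
            h.2.2.subset_compl_right
          exact ⟨C, hC, fun _ _ _ => ⟨h1, h2⟩⟩
        · exact ⟨∅, isClopen_empty, fun h1 h2 h3 => absurd ⟨h1, h2, h3⟩ h⟩
      obtain ⟨g, h1, h2, h3⟩ := he.1.exists_refinement hX he.2.1 he.2.2 hC
      refine ⟨g, fun _ _ _ => ⟨h1, h2, fun hA hB hd x hx y hy hxy => ?_⟩⟩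
      obtain ⟨hAC, hCB⟩ := hAB hA hB hd
      exact hCB ((h3 x y hxy).1 (hAC hx)) hy
    · exact ⟨fun _ => true, fun h1 h2 h3 => absurd ⟨h1, h2, h3⟩ he⟩
  choose g hg using hstep
  let E : ℕ → X → List Bool := fun n => Nat.rec (fun _ => []) (fun n e x => g n e x :: e x) n
  have hE : ∀ n, (fun x => res (fun k => g k (E k) x) n) = E n := by
    intro n
    induction n with
    | zero => rfl
    | succ n ih =>
      funext x
      rw [res_succ, congrFun ih x]
  have hmain : ∀ n, IsLocallyConstant (E n) ∧ ∀ s : List Bool, s.length = n → ∃ x, E n x = s := by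
    intro n
    induction n with
    | zero =>
      refine ⟨IsLocallyConstant.const [], fun s hs => ⟨Classical.arbitrary X, ?_⟩⟩
      exact (List.length_eq_zero_iff.1 hs).symm
    | succ n ih =>
      have := hg n (E n) ih.1 ih.2 (fun x => by rw [← hE]; exact res_length _ _)
      exact ⟨this.1, this.2.1⟩
  refine ⟨fun x k => g k (E k) x, fun n => ?_, fun s => ?_, fun n => ?_⟩
  · rw [hE]
    exact (hmain n).1
  · obtain ⟨x, hx⟩ := (hmain s.length).2 s rfl
    exact ⟨x, by rw [← hx, ← hE, res_length]⟩
  · intro hA hB hd x hx y hy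
    rw [hE] at hA hB hd hx hy
    have := (hg n (E n) (hmain n).1 (hmain n).2
      (fun x => by rw [← hE]; exact res_length _ _)).2.2 hA hB hd x hx y hy
    rwa [res_succ, res_succ, congrFun (hE n) x, congrFun (hE n) y]

end Coordinates

/-- Every set has an enumeration that lists distinct elements as long as there are any. -/
theorem Set.exists_enumeration {X : Type*} [Nonempty X] (A : Set X) :
    ∃ w : ℕ → X, (∀ k : ℕ, (k : ℕ∞) < A.encard → w k ∈ A) ∧
      (∀ k l : ℕ, (k : ℕ∞) < A.encard → (l : ℕ∞) < A.encard → w k = w l → k = l) ∧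
      (A.Finite → ∀ x ∈ A, ∃ k : ℕ, (k : ℕ∞) < A.encard ∧ w k = x) := by
  classical
  by_cases hA : A.Finite
  · let e := hA.toFinset.equivFin
    have hc : A.encard = (hA.toFinset.card : ℕ∞) := by
      rw [hA.encard_eq_coe_toFinset_card]
    simp only [hc, Nat.cast_lt]
    refine ⟨fun k => if h : k < hA.toFinset.card then (e.symm ⟨k, h⟩ : X) else
      Classical.arbitrary X, fun k hk => ?_, fun k l hk hl h => ?_, fun _ x hx => ?_⟩
    · simp only [hk, dif_pos]
      exact hA.mem_toFinset.1 (e.symm ⟨k, hk⟩).2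
    · simp only [hk, hl, dif_pos] at h
      simpa using e.symm.injective (Subtype.ext h)
    · refine ⟨e ⟨x, hA.mem_toFinset.2 hx⟩, Fin.is_lt _, ?_⟩
      simp
  · have hinf : A.Infinite := hA
    exact ⟨fun k => hinf.natEmbedding A k, fun k _ => (hinf.natEmbedding A k).2,
      fun k l _ _ h => (hinf.natEmbedding A).injective (Subtype.ext h), fun h => absurd h hA⟩

/-- An enumeration of a set that lists distinct elements as long as there are any. -/
noncomputable def Set.enumeration {X : Type*} [Nonempty X] (A : Set X) : ℕ → X :=
  A.exists_enumeration.choose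

/-! ### Formulas: countability, closedness of `¬□ψ`, invariance -/

namespace CountFormula

/-- The nesting depth of a formula. -/
def depth {Var : Type*} : CountFormula Var → ℕ
  | atom _ => 0
  | top => 0
  | neg φ => φ.depth + 1
  | and φ ψ => max φ.depth ψ.depth + 1
  | box φ => φ.depth + 1
  | count _ φ => φ.depth + 1

/-- Needed to schedule all pairs of names along `ℕ`. -/
instance {Var : Type*} [Countable Var] : Countable (CountFormula Var) := by
  have key : ∀ n : ℕ, {φ : CountFormula Var | φ.depth < n}.Countable := by
    intro n
    induction n with
    | zero => simp
    | succ n ih =>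
      have h := ((((countable_range (atom (Var := Var))).union (countable_singleton top)).union
        (ih.image neg)).union (ih.image2 ih and)).union ((ih.image box).union
        (countable_iUnion fun k : ℕ => ih.image (count k)))
      refine h.mono fun φ hφ => ?_
      simp only [mem_ofPred_eq] at hφ
      cases φ with
      | atom p => simp
      | top => simp
      | neg φ => simp [depth] at hφ ⊢; omega
      | and φ ψ => simp [depth] at hφ ⊢; omega
      | box φ => simp [depth] at hφ ⊢; omega
      | count k φ => simp [depth] at hφ ⊢; omega
  rw [← countable_univ_iff]
  refine (countable_iUnion key).mono fun φ _ => mem_iUnion.2 ⟨φ.depth + 1, ?_⟩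
  simp

section

variable {Var X : Type*} [TopologicalSpace X]

/-- The set of points where `□ψ` fails is closed. -/
theorem isClosed_not_trueAt_box (h : Var → Set X) (ψ : CountFormula Var) :
    IsClosed {x | ¬ TrueAt h (box ψ) x} := by
  rw [← isOpen_compl_iff, isOpen_iff_forall_mem_open]
  intro x hx
  obtain ⟨O, hO, hxO, hψ⟩ : TrueAt h (box ψ) x := not_not.1 hx
  exact ⟨O, fun y hy => not_not.2 ⟨O, hO, hy, hψ⟩, hO, hxO⟩

theorem trueAt_of_trueAt_box {h : Var → Set X} {ψ : CountFormula Var} {x : X}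
    (hx : TrueAt h (box ψ) x) : TrueAt h ψ x := by
  obtain ⟨O, -, hxO, hψ⟩ := hx
  exact hψ x hxO

/-- The formula `□ψ₁ ∨ □ψ₂`. -/
def boxOr (ψ₁ ψ₂ : CountFormula Var) : CountFormula Var :=
  neg (and (neg (box ψ₁)) (neg (box ψ₂)))

/-- The points satisfying either `□ψᵢ` form an open set, so the outer box changes nothing. Hence the
sets `¬□ψ` are closed under intersection. -/
theorem not_trueAt_box_boxOr {h : Var → Set X} {ψ₁ ψ₂ : CountFormula Var} {x : X} :
    ¬ TrueAt h (box (boxOr ψ₁ ψ₂)) x ↔ ¬ TrueAt h (box ψ₁) x ∧ ¬ TrueAt h (box ψ₂) x := by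
  refine ⟨fun hx => ?_, fun hx hb => trueAt_of_trueAt_box hb hx⟩
  constructor
  · rintro ⟨O, hO, hxO, hψ⟩
    exact hx ⟨O, hO, hxO, fun y hy hn => hn.1 ⟨O, hO, hy, hψ⟩⟩
  · rintro ⟨O, hO, hxO, hψ⟩
    exact hx ⟨O, hO, hxO, fun y hy hn => hn.2 ⟨O, hO, hy, hψ⟩⟩

theorem trueAt_homeomorph {Y : Type*} [TopologicalSpace Y] (e : X ≃ₜ Y) (h : Var → Set Y)
    (φ : CountFormula Var) (x : X) :
    TrueAt (fun p => e ⁻¹' h p) φ x ↔ TrueAt h φ (e x) := by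
  induction φ generalizing x with
  | atom p => rfl
  | top => rfl
  | neg φ ih => exact not_congr (ih x)
  | and φ ψ ih₁ ih₂ => exact and_congr (ih₁ x) (ih₂ x)
  | box φ ih =>
    constructor
    · rintro ⟨O, hO, hxO, hφ⟩
      refine ⟨e '' O, e.isOpenMap O hO, mem_image_of_mem e hxO, ?_⟩
      rintro _ ⟨y, hy, rfl⟩
      exact (ih y).1 (hφ y hy)
    · rintro ⟨O, hO, hxO, hφ⟩
      exact ⟨e ⁻¹' O, hO.preimage e.continuous, hxO, fun y hy => (ih y).2 (hφ _ hy)⟩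
  | count n φ ih =>
    simp only [TrueAt, ih]
    have : {y | TrueAt h φ y} = e '' {y | TrueAt h φ (e y)} := by
      rw [← preimage_ofPred_eq (f := e) (p := fun y => TrueAt h φ y),
        image_preimage_eq _ e.surjective]
    rw [this, e.injective.encard_image]

theorem Satisfiable.of_homeomorph {Y : Type*} [TopologicalSpace Y] (e : X ≃ₜ Y)
    {Γ : Set (CountFormula Var)} (hΓ : Satisfiable Y Γ) : Satisfiable X Γ := by
  obtain ⟨h, y, hy⟩ := hΓ
  refine ⟨fun p => e ⁻¹' h p, e.symm y, fun γ hγ => (trueAt_homeomorph e h γ _).2 ?_⟩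
  rw [e.apply_symm_apply]
  exact hy γ hγ

end

/-! ### Names and addressed models -/

/-- Names of points of an addressed model: `none` names the base point and `some (φ, s, k)` the
`k`-th point satisfying `φ` whose address begins with `s`. -/
abbrev PointCode (Var : Type*) := Option (CountFormula Var × List Bool × ℕ)

/-- Names of closed sets of an addressed model: singletons of named points, and the sets of points
that satisfy `¬□ψ` and whose address begins with `s`. -/
abbrev ClosedCode (Var : Type*) := PointCode Var ⊕ (List Bool × CountFormula Var)

section Codes

variable {Var X : Type*} [TopologicalSpace X] [Nonempty X]

/-- The point with a given name, where `S s` is the set of points whose address begins with `s`. -/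
noncomputable def codedPoint (h : Var → Set X) (b : X) (S : List Bool → Set X) :
    PointCode Var → X
  | none => b
  | some (φ, s, k) => ({x | TrueAt h φ x} ∩ S s).enumeration k

/-- The closed set with a given name. -/
def codedSet (h : Var → Set X) (b : X) (S : List Bool → Set X) : ClosedCode Var → Set X
  | .inl p => {codedPoint h b S p}
  | .inr (s, ψ) => {x | ¬ TrueAt h (box ψ) x} ∩ S s

/-- The number of coordinates of the address on which a named point depends. -/
def PointCode.level : PointCode Var → ℕ
  | none => 0
  | some (_, s, _) => s.length

/-- The number of coordinates of the address on which a named closed set depends. -/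
def ClosedCode.level : ClosedCode Var → ℕ
  | .inl p => PointCode.level p
  | .inr (s, _) => s.length

/-- This breaks a circularity: names refer to addresses, which are built by separating named sets. A
name is already determined once its `level` many coordinates exist. -/
theorem codedPoint_congr (h : Var → Set X) (b : X) {S T : List Bool → Set X} {n : ℕ}
    (hST : ∀ s : List Bool, s.length ≤ n → S s = T s) (p : PointCode Var)
    (hp : PointCode.level p ≤ n) : codedPoint h b S p = codedPoint h b T p := by
  match p, hp with
  | none, _ => rfl
  | some (φ, s, k), hp => simp only [codedPoint, hST s hp]

theorem codedSet_congr (h : Var → Set X) (b : X) {S T : List Bool → Set X} {n : ℕ}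
    (hST : ∀ s : List Bool, s.length ≤ n → S s = T s) (α : ClosedCode Var)
    (hα : ClosedCode.level α ≤ n) : codedSet h b S α = codedSet h b T α := by
  match α, hα with
  | .inl p, hp => simp only [codedSet, codedPoint_congr h b hST p hp]
  | .inr (s, ψ), hs => simp only [codedSet, hST s hs]

theorem isClosed_codedSet [T1Space X] (h : Var → Set X) (b : X) {S : List Bool → Set X}
    (α : ClosedCode Var) (hS : ∀ s, IsClosed (S s)) :
    IsClosed (codedSet h b S α) := by
  match α with
  | .inl p => exact isClosed_singleton
  | .inr (s, ψ) => exact (isClosed_not_trueAt_box h ψ).inter (hS s)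

end Codes

/-- The set of points whose address under `f` begins with `s`. -/
def addressSet {X : Type*} (f : X → ℕ → Bool) (s : List Bool) : Set X :=
  {x | res (f x) s.length = s}

/-- A topological model with a base point and an address map to the Cantor space, such that
disjoint named closed sets `α` and `β` are separated by the first `N α β` coordinates. -/
structure AddressedModel (Var X : Type*) [TopologicalSpace X] [Nonempty X]
    (N : ClosedCode Var → ClosedCode Var → ℕ) where
  val : Var → Set X
  base : X
  addr : X → ℕ → Bool
  isLocallyConstant : ∀ n, IsLocallyConstant fun x => res (addr x) n
  surj : ∀ s : List Bool, ∃ x, res (addr x) s.length = s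
  separated : ∀ α β, Disjoint (codedSet val base (addressSet addr) α)
    (codedSet val base (addressSet addr) β) →
    ∀ x ∈ codedSet val base (addressSet addr) α, ∀ y ∈ codedSet val base (addressSet addr) β,
      res (addr x) (N α β) ≠ res (addr y) (N α β)

theorem _root_.PiNat.res_eq_res_of_le {u v : ℕ → Bool} {m n : ℕ} (hmn : m ≤ n)
    (h : res u n = res v n) : res u m = res v m :=
  res_eq_res.2 fun _ hk => res_eq_res.1 h (hk.trans_le hmn)

theorem _root_.PiNat.isSuffix_res_iff {u : ℕ → Bool} {s : List Bool} {n : ℕ} (hs : s.length ≤ n) :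
    s <:+ res u n ↔ res u s.length = s := by
  have h : res u s.length <:+ res u n := by
    induction hs with
    | refl => exact List.suffix_rfl
    | step _ ih => exact ih.trans (List.suffix_cons _ _)
  constructor
  · intro hsn
    exact (List.suffix_of_suffix_length_le h hsn (by simp)).eq_of_length (by simp)
  · intro hu
    rwa [hu] at h

/-- Every model on a Stone space without isolated points can be addressed, with separation levels
that do not depend on the model. -/
theorem exists_addressedModel {Var X : Type*} [Countable Var] [TopologicalSpace X] [CompactSpace X]
    [T2Space X] [TotallyDisconnectedSpace X] [Nonempty X] (hX : ∀ x : X, ¬ IsOpen {x}) :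
    ∃ N : ClosedCode Var → ClosedCode Var → ℕ, ∀ (h : Var → Set X) (b : X),
      ∃ M : AddressedModel Var X N, M.val = h ∧ M.base = b := by
  obtain ⟨e, he⟩ := exists_surjective_nat (ClosedCode Var × ClosedCode Var)
  have hreq : ∀ α β : ClosedCode Var, ∃ n, e n.unpair.1 = (α, β) ∧ ClosedCode.level α ≤ n ∧
      ClosedCode.level β ≤ n := by
    intro α β
    obtain ⟨k, hk⟩ := he (α, β)
    -- The first component recalls the pair of names; the second delays its treatment until both
    -- sets are determined. Neither depends on the model.
    refine ⟨Nat.pair k (max (ClosedCode.level α) (ClosedCode.level β)), ?_, ?_, ?_⟩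
    · simp [hk]
    · exact (le_max_left _ _).trans (Nat.right_le_pair _ _)
    · exact (le_max_right _ _).trans (Nat.right_le_pair _ _)
  choose N hN hα hβ using hreq
  -- A pair treated at stage `N α β` is separated by the coordinate with that index, which is
  -- visible only in the first `N α β + 1` coordinates.
  refine ⟨fun α β => N α β + 1, fun h b => ?_⟩
  -- `res` lists the latest coordinate first, so an initial segment of an address is a suffix of the
  -- list.
  obtain ⟨f, h1, h2, h3⟩ := exists_separating_coordinates hX
    (fun n a => codedSet h b (fun s => {x | s <:+ a x}) (e n.unpair.1).1)
    (fun n a => codedSet h b (fun s => {x | s <:+ a x}) (e n.unpair.1).2)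
  refine ⟨⟨h, b, f, h1, h2, fun α β hd x hx y hy => ?_⟩, rfl, rfl⟩
  have hcl : ∀ s, IsClosed {x | s <:+ res (f x) (N α β)} := fun s =>
    isOpen_compl_iff.1 (h1 (N α β) {l | ¬ s <:+ l})
  have hST : ∀ s : List Bool, s.length ≤ N α β →
      {x | s <:+ res (f x) (N α β)} = addressSet f s := fun s hs => by
    ext x
    exact isSuffix_res_iff hs
  have := h3 (N α β)
  simp only [hN] at this
  rw [codedSet_congr h b hST α (hα α β), codedSet_congr h b hST β (hβ α β)] at this
  refine this ?_ ?_ hd x hx y hy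
  · rw [← codedSet_congr h b hST α (hα α β)]
    exact isClosed_codedSet h b α hcl
  · rw [← codedSet_congr h b hST β (hβ α β)]
    exact isClosed_codedSet h b β hcl

end CountFormula

namespace CountFormula

namespace AddressedModel

section

variable {Var X : Type*} [TopologicalSpace X] [Nonempty X]
  {N : ClosedCode Var → ClosedCode Var → ℕ}

/-- The named point `p` of an addressed model. -/
noncomputable def point (M : AddressedModel Var X N) (p : PointCode Var) : X :=
  codedPoint M.val M.base (addressSet M.addr) p

variable (M : AddressedModel Var X N)

theorem point_mem {φ : CountFormula Var} {s : List Bool} {k : ℕ}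
    (hk : (k : ℕ∞) < ({x | TrueAt M.val φ x} ∩ addressSet M.addr s).encard) :
    M.point (some (φ, s, k)) ∈ {x | TrueAt M.val φ x} ∩ addressSet M.addr s :=
  (exists_enumeration _).choose_spec.1 k hk

theorem point_injective {φ : CountFormula Var} {s : List Bool} {k l : ℕ}
    (hk : (k : ℕ∞) < ({x | TrueAt M.val φ x} ∩ addressSet M.addr s).encard)
    (hl : (l : ℕ∞) < ({x | TrueAt M.val φ x} ∩ addressSet M.addr s).encard)
    (h : M.point (some (φ, s, k)) = M.point (some (φ, s, l))) : k = l :=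
  (exists_enumeration _).choose_spec.2.1 k l hk hl h

theorem exists_point_eq {φ : CountFormula Var} {n : ℕ}
    (hn : {x | TrueAt M.val φ x}.encard ≤ n) {x : X} (hx : TrueAt M.val φ x) :
    ∃ k < n, M.point (some (φ, [], k)) = x := by
  have huniv : {x | TrueAt M.val φ x} ∩ addressSet M.addr [] = {x | TrueAt M.val φ x} :=
    inter_eq_left.2 fun _ _ => rfl
  obtain ⟨k, hk, hkx⟩ :=
    (exists_enumeration ({x | TrueAt M.val φ x} ∩ addressSet M.addr [])).choose_spec.2.2
      (by rw [huniv]; exact finite_of_encard_le_coe hn) x (by rw [huniv]; exact hx)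
  rw [huniv] at hk
  exact ⟨k, by exact_mod_cast hk.trans_le hn, hkx⟩

theorem res_point_ne {p q : PointCode Var} (h : M.point p ≠ M.point q) :
    res (M.addr (M.point p)) (N (.inl p) (.inl q)) ≠
      res (M.addr (M.point q)) (N (.inl p) (.inl q)) :=
  M.separated (.inl p) (.inl q) (disjoint_singleton.2 h) _ rfl _ rfl

end

/-! ### The limit model along an ultrafilter -/

section Limit

variable {Var X I : Type*} [TopologicalSpace X] [Nonempty X]
  {N : ClosedCode Var → ClosedCode Var → ℕ} (U : Ultrafilter I) (M : I → AddressedModel Var X N)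

open Classical in
/-- The limit along `U` of the addresses of a family of points. -/
noncomputable def limitAddr (x : I → X) : ℕ → Bool :=
  fun n => decide (∀ᶠ i in U, (M i).addr (x i) n = true)

theorem eventually_res_eq_limitAddr (x : I → X) (n : ℕ) :
    ∀ᶠ i in U, res ((M i).addr (x i)) n = res (limitAddr U M x) n := by
  induction n with
  | zero => exact Eventually.of_forall fun _ => rfl
  | succ n ih =>
    have h : ∀ᶠ i in U, (M i).addr (x i) n = limitAddr U M x n := by
      by_cases hx : ∀ᶠ i in U, (M i).addr (x i) n = true
      · filter_upwards [hx] with i hi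
        simp [limitAddr, hx, hi]
      · have hx' := Ultrafilter.eventually_not.2 hx
        filter_upwards [hx'] with i hi
        simpa [limitAddr, hx] using hi
    filter_upwards [ih, h] with i h1 h2
    rw [res_succ, res_succ, h1, h2]

/-- The limit along `U` of the addresses of the named points `p`. -/
noncomputable def limitPoint (p : PointCode Var) : ℕ → Bool :=
  limitAddr U M fun i => (M i).point p

theorem eq_limitPoint {p : PointCode Var} {u : ℕ → Bool}
    (h : ∀ n, ∀ᶠ i in U, res ((M i).addr ((M i).point p)) n = res u n) : u = limitPoint U M p := by
  apply res_injective
  funext n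
  obtain ⟨i, h1, h2⟩ := ((h n).and (eventually_res_eq_limitAddr U M (fun i => (M i).point p) n)).exists
  exact h1.symm.trans h2

/-- Otherwise the two points would differ in almost all models, hence differ within one fixed number
of coordinates, and so would their limits. -/
theorem eventually_point_eq {p q : PointCode Var} (h : limitPoint U M p = limitPoint U M q) :
    ∀ᶠ i in U, (M i).point p = (M i).point q := by
  by_contra hne
  have hne' := Ultrafilter.eventually_not.2 hne
  obtain ⟨i, hi, hp, hq⟩ := (hne'.and
    ((eventually_res_eq_limitAddr U M (fun i => (M i).point p) (N (.inl p) (.inl q))).and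
    (eventually_res_eq_limitAddr U M (fun i => (M i).point q) (N (.inl p) (.inl q))))).exists
  refine (M i).res_point_ne hi ?_
  rw [hp, hq]
  exact congrArg (fun u => res u _) h

/-- Points satisfying `¬□ψ` accumulate at the address `u`. -/
def Accumulates (u : ℕ → Bool) (ψ : CountFormula Var) : Prop :=
  ∀ n, ∀ᶠ i in U, ∃ x, ¬ TrueAt (M i).val (box ψ) x ∧ res ((M i).addr x) n = res u n

theorem accumulates_neg_top (u : ℕ → Bool) : Accumulates U M u (neg top) := by
  intro n
  refine Eventually.of_forall fun i => ?_
  obtain ⟨x, hx⟩ := (M i).surj (res u n)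
  rw [res_length] at hx
  exact ⟨x, fun hb => trueAt_of_trueAt_box hb trivial, hx⟩

/-- If the conjunction failed to accumulate, then on some cylinder around `u` the two closed sets
would be disjoint in almost all models, hence separated at a fixed level, although both reach `u` up
to that level. This makes the accumulating `¬□ψ` directed. -/
theorem Accumulates.boxOr {u : ℕ → Bool} {ψ₁ ψ₂ : CountFormula Var} (h₁ : Accumulates U M u ψ₁)
    (h₂ : Accumulates U M u ψ₂) : Accumulates U M u (boxOr ψ₁ ψ₂) := by
  by_contra hcon
  simp only [Accumulates, not_forall, not_trueAt_box_boxOr] at hcon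
  obtain ⟨n, hn⟩ := hcon
  let α : CountFormula Var → ClosedCode Var := fun ψ => .inr (res u n, ψ)
  obtain ⟨i, hi, ⟨x, hx, hxu⟩, y, hy, hyu⟩ := ((Ultrafilter.eventually_not.2 hn).and
    ((h₁ (max n (N (α ψ₁) (α ψ₂)))).and (h₂ (max n (N (α ψ₁) (α ψ₂)))))).exists
  have hmem : ∀ (ψ : CountFormula Var) (z : X), z ∈ codedSet (M i).val (M i).base
      (addressSet (M i).addr) (α ψ) ↔
      ¬ TrueAt (M i).val (box ψ) z ∧ res ((M i).addr z) n = res u n := by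
    intro ψ z
    change _ ∧ res ((M i).addr z) (res u n).length = res u n ↔ _
    rw [res_length]
    rfl
  refine (M i).separated (α ψ₁) (α ψ₂) ?_ x ?_ y ?_ ?_
  · refine Set.disjoint_left.2 fun z hz₁ hz₂ => hi ⟨z, ⟨?_, ?_⟩, ?_⟩
    · exact ((hmem _ _).1 hz₁).1
    · exact ((hmem _ _).1 hz₂).1
    · exact ((hmem _ _).1 hz₁).2
  · exact (hmem _ _).2 ⟨hx, res_eq_res_of_le (le_max_left _ _) hxu⟩
  · exact (hmem _ _).2 ⟨hy, res_eq_res_of_le (le_max_left _ _) hyu⟩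
  · exact (res_eq_res_of_le (le_max_right _ _) hxu).trans
      (res_eq_res_of_le (le_max_right _ _) hyu).symm

/-- The filter on pairs of an index and a point generated by the sets of points satisfying `¬□ψ`
with address close to `u`, where `ψ` ranges over the formulas for which these points accumulate
at `u`. -/
def accumulationFilter (u : ℕ → Bool) : Filter (I × X) where
  sets := {A | ∃ ψ, Accumulates U M u ψ ∧ ∃ n, ∀ᶠ i in U, ∀ x,
    ¬ TrueAt (M i).val (box ψ) x → res ((M i).addr x) n = res u n → (i, x) ∈ A}
  univ_sets := ⟨neg top, accumulates_neg_top U M u, 0,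
    Eventually.of_forall fun _ _ _ _ => mem_univ _⟩
  sets_of_superset := by
    rintro A B ⟨ψ, hψ, n, h⟩ hAB
    exact ⟨ψ, hψ, n, h.mono fun i hi x h1 h2 => hAB (hi x h1 h2)⟩
  inter_sets := by
    rintro A B ⟨ψ₁, hψ₁, n₁, h₁⟩ ⟨ψ₂, hψ₂, n₂, h₂⟩
    refine ⟨_, hψ₁.boxOr U M hψ₂, max n₁ n₂, ?_⟩
    filter_upwards [h₁, h₂] with i h₁ h₂ x hx hxu
    rw [not_trueAt_box_boxOr] at hx
    exact ⟨h₁ x hx.1 (res_eq_res_of_le (le_max_left _ _) hxu),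
      h₂ x hx.2 (res_eq_res_of_le (le_max_right _ _) hxu)⟩

/-- An ultrafilter on pairs of an index and a point lies over the address `u` if it projects to
`U`, its addresses converge to `u`, and it contains `¬□ψ` whenever `¬□ψ` accumulates at `u`. -/
structure LiesOver (D : Ultrafilter (I × X)) (u : ℕ → Bool) : Prop where
  eventually_fst : ∀ {P : I → Prop}, (∀ᶠ i in U, P i) → ∀ᶠ z : I × X in D, P z.1
  eventually_res : ∀ n, ∀ᶠ z : I × X in D, res ((M z.1).addr z.2) n = res u n
  not_box : ∀ ψ, Accumulates U M u ψ → ∀ᶠ z : I × X in D, ¬ TrueAt (M z.1).val (box ψ) z.2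

theorem exists_liesOver (u : ℕ → Bool) : ∃ D : Ultrafilter (I × X), LiesOver U M D u := by
  have hne : (accumulationFilter U M u).NeBot := by
    refine ⟨fun hbot => ?_⟩
    obtain ⟨ψ, hψ, n, h⟩ := empty_mem_iff_bot.2 hbot
    obtain ⟨i, ⟨x, hx, hxu⟩, hi⟩ := ((hψ n).and h).exists
    exact hi x hx hxu
  have hle := Ultrafilter.of_le (accumulationFilter U M u)
  refine ⟨Ultrafilter.of (accumulationFilter U M u), ⟨fun {P} hP => hle ?_, fun n => hle ?_,
    fun ψ hψ => hle ?_⟩⟩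
  · exact ⟨_, accumulates_neg_top U M u, 0, hP.mono fun i hi _ _ _ => hi⟩
  · exact ⟨_, accumulates_neg_top U M u, n, Eventually.of_forall fun i _ _ hxu => hxu⟩
  · exact ⟨ψ, hψ, 0, Eventually.of_forall fun i _ hx _ => hx⟩

/-- If `□ψ` held at the named point in almost all models, its singleton would be disjoint from the
closed set `¬□ψ`, so a fixed number of coordinates would keep that set away from the limit. -/
theorem liesOver_limitPoint (p : PointCode Var) :
    LiesOver U M (U.map fun i => (i, (M i).point p)) (limitPoint U M p) := by
  refine ⟨fun hP => hP, fun n => eventually_res_eq_limitAddr U M _ n, fun ψ hψ => ?_⟩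
  by_contra hcon
  have hbox : ∀ᶠ i in U, TrueAt (M i).val (box ψ) ((M i).point p) := by
    by_contra h
    exact hcon (Ultrafilter.eventually_not.2 h)
  let β : ClosedCode Var := .inr ([], ψ)
  obtain ⟨i, hi, ⟨x, hx, hxu⟩, hpu⟩ := (hbox.and ((hψ (N (.inl p) β)).and
    (eventually_res_eq_limitAddr U M (fun i => (M i).point p) (N (.inl p) β)))).exists
  refine (M i).separated (.inl p) β ?_ ((M i).point p) rfl x ⟨hx, rfl⟩ (hpu.trans hxu.symm)
  exact disjoint_singleton_left.2 fun h => h.1 hi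

/-- The prescription at limit points is consistent because names with the same limit denote the same
point in almost all models. -/
theorem exists_liesOver_eq_map (u : ℕ → Bool) : ∃ D : Ultrafilter (I × X), LiesOver U M D u ∧
    ∀ p, u = limitPoint U M p → D = U.map fun i => (i, (M i).point p) := by
  by_cases hu : ∃ p, u = limitPoint U M p
  · obtain ⟨p, rfl⟩ := hu
    refine ⟨_, liesOver_limitPoint U M p, fun q hq => ?_⟩
    refine Ultrafilter.coe_injective ?_
    refine Filter.map_congr ?_
    filter_upwards [eventually_point_eq U M hq] with i hi
    rw [hi]
  · obtain ⟨D, hD⟩ := exists_liesOver U M u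
    exact ⟨D, hD, fun p hp => absurd ⟨p, hp⟩ hu⟩

/-- The ultrafilter that determines which formulas hold at the address `u` of the limit model. -/
noncomputable def typeAt (u : ℕ → Bool) : Ultrafilter (I × X) :=
  (exists_liesOver_eq_map U M u).choose

theorem liesOver_typeAt (u : ℕ → Bool) : LiesOver U M (typeAt U M u) u :=
  (exists_liesOver_eq_map U M u).choose_spec.1

theorem eventually_typeAt_limitPoint {p : PointCode Var} {φ : CountFormula Var} :
    (∀ᶠ z : I × X in typeAt U M (limitPoint U M p), TrueAt (M z.1).val φ z.2) ↔
      ∀ᶠ i in U, TrueAt (M i).val φ ((M i).point p) := by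
  unfold typeAt
  rw [(exists_liesOver_eq_map U M (limitPoint U M p)).choose_spec.2 p rfl]
  rfl

variable {U M} in
theorem LiesOver.eventually_of_fst {D : Ultrafilter (I × X)} {u : ℕ → Bool}
    (hD : LiesOver U M D u) {P : I → Prop} (h : ∀ᶠ z : I × X in D, P z.1) : ∀ᶠ i in U, P i := by
  by_contra hcon
  obtain ⟨z, h1, h2⟩ := (h.and (hD.eventually_fst (Ultrafilter.eventually_not.2 hcon))).exists
  exact h2 h1

-- When at most `n` points satisfy `φ`, all of them are named by some `k < n`; the ultrafilter `D`
-- selects one such `k`, whose limit must be `u`.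
variable {U M} in
theorem LiesOver.exists_eq_limitPoint {D : Ultrafilter (I × X)} {u : ℕ → Bool}
    (hD : LiesOver U M D u) {φ : CountFormula Var} {n : ℕ}
    (hn : ∀ᶠ i in U, {x | TrueAt (M i).val φ x}.encard ≤ n)
    (hφ : ∀ᶠ z : I × X in D, TrueAt (M z.1).val φ z.2) :
    ∃ k < n, u = limitPoint U M (some (φ, [], k)) := by
  have h : ∀ᶠ z : I × X in D, ∃ k ∈ Set.Iio n, (M z.1).point (some (φ, [], k)) = z.2 := by
    filter_upwards [hD.eventually_fst hn, hφ] with z h1 h2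
    exact (M z.1).exists_point_eq h1 h2
  obtain ⟨k, hk, hkD⟩ := (Ultrafilter.eventually_exists_mem_iff (finite_Iio n)).1 h
  refine ⟨k, hk, eq_limitPoint U M fun m => ?_⟩
  refine hD.eventually_of_fst (P := fun i => res ((M i).addr ((M i).point _)) m = res u m) ?_
  filter_upwards [hkD, hD.eventually_res m] with z h1 h2
  rw [h1, h2]

/-- The assignment of the limit model. -/
def limitVal (p : Var) : Set (ℕ → Bool) :=
  {u | ∀ᶠ z : I × X in typeAt U M u, TrueAt (M z.1).val (atom p) z.2}

theorem _root_.PiNat.exists_res_subset_of_isOpen {O : Set (ℕ → Bool)} (hO : IsOpen O)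
    {u : ℕ → Bool} (hu : u ∈ O) : ∃ n, ∀ v, res v n = res u n → v ∈ O := by
  obtain ⟨_, ⟨w, n, rfl⟩, huw, hwO⟩ :=
    (isTopologicalBasis_cylinders fun _ : ℕ => Bool).exists_subset_of_mem_open hu hO
  refine ⟨n, fun v hv => hwO ?_⟩
  rw [cylinder_eq_res] at huw ⊢
  exact hv.trans huw

theorem _root_.PiNat.isOpen_res_eq (u : ℕ → Bool) (n : ℕ) :
    IsOpen {v : ℕ → Bool | res v n = res u n} := by
  rw [← cylinder_eq_res]
  exact isOpen_cylinder _ _ _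

/-- An analogue of Łoś's theorem. For `□`, non-accumulation of `¬□ψ` gives a cylinder on which `ψ`
holds, while a failure of `□ψ` puts limits of named `¬ψ` points in every neighbourhood. For
counting, named witnesses neither merge in the limit nor acquire unnamed companions when they are
finitely many. -/
theorem trueAt_limitVal_iff (φ : CountFormula Var) (u : ℕ → Bool) :
    TrueAt (limitVal U M) φ u ↔ ∀ᶠ z : I × X in typeAt U M u, TrueAt (M z.1).val φ z.2 := by
  induction φ generalizing u with
  | atom p => rfl
  | top => exact iff_of_true trivial (Eventually.of_forall fun _ => trivial)
  | neg φ ih => exact (not_congr (ih u)).trans Ultrafilter.eventually_not.symm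
  | and φ ψ ih₁ ih₂ => exact (and_congr (ih₁ u) (ih₂ u)).trans eventually_and.symm
  | box ψ ih =>
    have hD := liesOver_typeAt U M u
    constructor
    · rintro ⟨O, hO, huO, hψ⟩
      obtain ⟨n, hn⟩ := exists_res_subset_of_isOpen hO huO
      by_contra hcon
      -- One witness of `¬ψ` in the cylinder suffices, hence index 0.
      let p : PointCode Var := some (neg ψ, res u n, 0)
      have hp : ∀ᶠ i in U, (M i).point p ∈
          {x | TrueAt (M i).val (neg ψ) x} ∩ addressSet (M i).addr (res u n) := by
        refine hD.eventually_of_fst (P := fun i => (M i).point p ∈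
          {x | TrueAt (M i).val (neg ψ) x} ∩ addressSet (M i).addr (res u n)) ?_
        filter_upwards [Ultrafilter.eventually_not.2 hcon, hD.eventually_res n] with z h1 h2
        refine (M z.1).point_mem ?_
        rw [Nat.cast_zero, encard_pos]
        by_contra hemp
        refine h1 ⟨{x | res ((M z.1).addr x) n = res u n},
          (M z.1).isLocallyConstant n {res u n}, h2, fun y hy => ?_⟩
        by_contra hyψ
        refine hemp ⟨y, hyψ, ?_⟩
        change res ((M z.1).addr y) (res u n).length = res u n
        rw [res_length]
        exact hy
      have hpO : limitPoint U M p ∈ O := by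
        refine hn _ ?_
        obtain ⟨i, h1, h2⟩ :=
          (hp.and (eventually_res_eq_limitAddr U M (fun i => (M i).point p) n)).exists
        have h3 : res ((M i).addr ((M i).point p)) (res u n).length = res u n := h1.2
        rw [res_length] at h3
        exact h2.symm.trans h3
      obtain ⟨i, h1, h2⟩ :=
        (hp.and ((eventually_typeAt_limitPoint U M).1 ((ih _).1 (hψ _ hpO)))).exists
      exact h1.1 h2
    · intro hbox
      have hacc : ¬ Accumulates U M u ψ := fun h => by
        obtain ⟨z, h1, h2⟩ := (hbox.and (hD.not_box ψ h)).exists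
        exact h2 h1
      simp only [Accumulates, not_forall] at hacc
      obtain ⟨n, hn⟩ := hacc
      refine ⟨_, isOpen_res_eq u n, rfl, fun v hv => (ih v).2 ?_⟩
      have hDv := liesOver_typeAt U M v
      filter_upwards [hDv.eventually_fst (Ultrafilter.eventually_not.2 hn),
        hDv.eventually_res n] with z h1 h2
      by_contra hzψ
      exact h1 ⟨z.2, fun hb => hzψ (trueAt_of_trueAt_box hb), h2.trans hv⟩
  | count n φ ih =>
    have hD := liesOver_typeAt U M u
    simp only [TrueAt, ih]
    constructor
    · intro hlt
      by_contra hcon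
      have hle : ∀ᶠ i in U, {x | TrueAt (M i).val φ x}.encard ≤ n :=
        hD.eventually_of_fst ((Ultrafilter.eventually_not.2 hcon).mono fun z hz => not_lt.1 hz)
      refine hlt.not_ge ?_
      have hsub : {v | ∀ᶠ z : I × X in typeAt U M v, TrueAt (M z.1).val φ z.2} ⊆
          (fun k => limitPoint U M (some (φ, [], k))) '' (Set.Iio n) := by
        intro v hv
        obtain ⟨k, hk, rfl⟩ := (liesOver_typeAt U M v).exists_eq_limitPoint hle hv
        exact ⟨k, hk, rfl⟩
      refine (encard_le_encard hsub).trans ((encard_image_le _ _).trans ?_)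
      rw [← Finset.coe_Iio, encard_coe_eq_coe_finsetCard, Nat.card_Iio]
    · intro h
      have hlt : ∀ᶠ i in U, (n : ℕ∞) < {x | TrueAt (M i).val φ x}.encard :=
        hD.eventually_of_fst h
      have huniv : ∀ i, {x | TrueAt (M i).val φ x} ∩ addressSet (M i).addr [] =
          {x | TrueAt (M i).val φ x} := fun i => inter_eq_left.2 fun _ _ => rfl
      have hk : ∀ k ≤ n, ∀ᶠ i in U, (k : ℕ∞) <
          ({x | TrueAt (M i).val φ x} ∩ addressSet (M i).addr []).encard := by
        intro k hk
        filter_upwards [hlt] with i hi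
        rw [huniv]
        exact lt_of_le_of_lt (by exact_mod_cast hk) hi
      have hinj : Set.InjOn (fun k => limitPoint U M (some (φ, [], k))) (Set.Iic n) := by
        intro k hkn l hln hkl
        obtain ⟨i, h1, h2, h3⟩ :=
          ((hk k hkn).and ((hk l hln).and (eventually_point_eq U M hkl))).exists
        exact (M i).point_injective h1 h2 h3
      have hsub : (fun k => limitPoint U M (some (φ, [], k))) '' (Set.Iic n) ⊆
          {v | ∀ᶠ z : I × X in typeAt U M v, TrueAt (M z.1).val φ z.2} := by
        rintro _ ⟨k, hkn, rfl⟩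
        refine (eventually_typeAt_limitPoint U M).2 ?_
        filter_upwards [hk k hkn] with i hi
        exact ((M i).point_mem hi).1
      refine lt_of_lt_of_le ?_ (encard_le_encard hsub)
      rw [hinj.encard_image, ← Finset.coe_Iic, encard_coe_eq_coe_finsetCard, Nat.card_Iic]
      exact_mod_cast n.lt_succ_self

end Limit

end AddressedModel

end CountFormula

/-! ### Compactness -/

namespace CountFormula

/-- No point of the Cantor space is isolated. -/
theorem _root_.PiNat.not_isOpen_singleton (x : ℕ → Bool) : ¬ IsOpen {x} := by
  intro h
  obtain ⟨n, hn⟩ := exists_res_subset_of_isOpen h (mem_singleton x)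
  have hmem : Function.update x n (!x n) = x := hn _ (res_eq_res.2 fun m hm =>
    Function.update_of_ne hm.ne _ _)
  simpa using congrFun hmem n

/-- The language with counting modalities is compact over the Cantor space `ℕ → Bool`. -/
theorem languageCompactOver_nat_bool (Var : Type*) [Countable Var] :
    LanguageCompactOver Var (ℕ → Bool) := by
  intro Γ hΓ
  have hfin : ∀ F : Finset Γ, Satisfiable (ℕ → Bool) ((fun γ : Γ => (γ : CountFormula Var)) '' F) :=
    fun F => hΓ _ (by rintro _ ⟨γ, -, rfl⟩; exact γ.2) (F.finite_toSet.image _)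
  choose h b hb using hfin
  obtain ⟨N, hN⟩ := exists_addressedModel (Var := Var) PiNat.not_isOpen_singleton
  choose M hval hbase using fun F => hN (h F) (b F)
  -- Being finer than `atTop`, `U` concentrates, for each `γ`, on the finite sets containing `γ`.
  let U : Ultrafilter (Finset Γ) := Ultrafilter.of atTop
  refine ⟨AddressedModel.limitVal U M, AddressedModel.limitPoint U M none, fun γ hγ => ?_⟩
  rw [AddressedModel.trueAt_limitVal_iff, AddressedModel.eventually_typeAt_limitPoint]
  have hU : (U : Filter (Finset Γ)) ≤ atTop := Ultrafilter.of_le _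
  filter_upwards [hU (eventually_ge_atTop {⟨γ, hγ⟩})] with F hF
  have hpt : (M F).point none = b F := hbase F
  rw [hpt, hval]
  exact hb F γ ⟨⟨γ, hγ⟩, hF (Finset.mem_singleton_self _), rfl⟩

end CountFormula

theorem mainTheorem5 {Var : Type*} [Countable Var] [Infinite Var] :
    CountFormula.LanguageCompactOver Var cantorSet := fun Γ hΓ =>
  (CountFormula.languageCompactOver_nat_bool Var Γ fun Γ₀ hsub hfin =>
    (hΓ Γ₀ hsub hfin).of_homeomorph cantorSetHomeomorphNatToBool.symm).of_homeomorph
      cantorSetHomeomorphNatToBool
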